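/- Let $n \ge 100$ be an integer, let $\alpha > 0$, $\beta = \frac{1}{10\sqrt{n-1}}$ and $0 < \eta \le \frac{1}{2+\exp(54\sqrt n)}$. Let $P$ be the following distribution of $(\mathbf{x},y) \in \mathbf{R}^n \times \{-1,1\}$: the label $y$ is $1$ or $-1$ with probability $1/2$ each; given $y$, the features $x_1,\dots,x_n$ are independent; $x_1 = \alpha y$ with probability $1-\eta$ and $x_1 = -\alpha y$ with probability $\eta$; and for $2 \le i \le n$, $x_i = y$ with probability $1/2+\beta$ and $x_i = -y$ with probability $1/2-\beta$. Let $\ell(z) = \ln(1+e^{-z})$ be the logistic loss. For dropout probability $q = 1/2$ and $p = 1-q$, let $b_1,\dots,b_n$ be independent of each other and of $(\mathbf{x},y)$, with $b_i = 1/p - 1$ with probability $p$ and $b_i = -1$ with probability $q$, and put $\nu_i = b_i x_i$. Then the dropout criterion $$\mathbf{w} \mapsto \mathbf{E}\big(\ell(y\,\mathbf{w}\cdot(\mathbf{x}+\boldsymbol{\nu}))\big)$$ has a unique minimizer $\mathbf{w}^*$ in $\mathbf{R}^n$; it predicts with $x_1$ alone, that is, $\mathrm{sign}(\mathbf{w}^*\cdot\mathbf{x})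 = \mathrm{sign}(x_1)$ with probability $1$; and its error rate is exactly $\eta$: $$\Pr_{(\mathbf{x},y)\sim P}\big(\mathrm{sign}(\mathbf{w}^*\cdot\mathbf{x}) \ne y\big) = \eta .$$ -/

import Mathlib

open MeasureTheory
open scoped ENNReal

noncomputable section

/-- The law on `ℝ` with value `a` with probability `p` and value `b` with probability `1 - p`. -/
def twoPoint (p a b : ℝ) : Measure ℝ :=
  ENNReal.ofReal p • Measure.dirac a + ENNReal.ofReal (1 - p) • Measure.dirac b

/-- The logistic loss. -/
def logisticLoss (z : ℝ) : ℝ := Real.log (1 + Real.exp (-z))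

/-- The law of `b = (b₁, …, bₙ)`: independent coordinates, each equal to `1/p - 1` with probability
`p = 1 - q` and to `-1` with probability `q`. The additive dropout noise is `νᵢ = bᵢ xᵢ`. -/
def dropoutNoise (n : ℕ) (q : ℝ) : Measure (Fin n → ℝ) :=
  Measure.pi fun _ => twoPoint (1 - q) (1 / (1 - q) - 1) (-1)

/-- The dropout criterion: the expectation of `ℓ (y w · (x + ν))` with `νᵢ = bᵢ xᵢ`, where `(x, y)`
is drawn from `P` and, independently, `b` from `dropoutNoise n q`. -/
def dropoutCriterion {n : ℕ} (P : Measure ((Fin n → ℝ) × ℝ)) (q : ℝ) (w : Fin n → ℝ) : ℝ :=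
  ∫ t, logisticLoss (t.1.2 * ∑ i, w i * (t.1.1 i + t.2 i * t.1.1 i)) ∂(P.prod (dropoutNoise n q))

/-- `w` is a global minimizer over `ℝⁿ` of the dropout criterion. -/
def IsDropoutMinimizer {n : ℕ} (P : Measure ((Fin n → ℝ) × ℝ)) (q : ℝ) (w : Fin n → ℝ) : Prop :=
  ∀ w' : Fin n → ℝ, dropoutCriterion P q w ≤ dropoutCriterion P q w'

/-- The error rate of the linear classifier `x ↦ sign (w · x)`. -/
def errorRate {n : ℕ} (P : Measure ((Fin n → ℝ) × ℝ)) (w : Fin n → ℝ) : ℝ :=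
  P.real {z | Real.sign (∑ i, w i * z.1 i) ≠ z.2}

/-- The law of the `i`-th feature given the label `y`; the first feature has index `0`. -/
def featureLaw (α β η y : ℝ) {n : ℕ} (i : Fin n) : Measure ℝ :=
  if (i : ℕ) = 0 then twoPoint (1 - η) (α * y) (-(α * y)) else twoPoint (1 / 2 + β) y (-y)

/-- The joint law of `(x, y)` when the label is fixed to be `y` and the features are drawn
independently given the label. -/
def sourceGiven (n : ℕ) (α β η y : ℝ) : Measure ((Fin n → ℝ) × ℝ) :=
  (Measure.pi fun i : Fin n => featureLaw α β η y i).prod (Measure.dirac y)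

/-- The source: the label is `1` or `-1`, equally likely. -/
def source (n : ℕ) (α β η : ℝ) : Measure ((Fin n → ℝ) × ℝ) :=
  (1 / 2 : ℝ≥0∞) • sourceGiven n α β η 1 + (1 / 2 : ℝ≥0∞) • sourceGiven n α β η (-1)

end

/-! Multiplying by the label makes the two label values contribute equally, so the criterion is a
finite sum `finiteRisk` over independent features, each of which is zeroed or doubled. Because any
single feature can be the only one kept, this risk is coercive and strictly convex. Hence the
minimizer exists and is unique, and by symmetry all `m = n - 1` weak features share one weight `v`.

The weight `v` is small (`weak_weight_bound`). The risk at the minimizer is at most `log 2`, its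
value at `0`, and the first feature is dropped half the time, so the weak features alone have risk
at most `2 log 2`. Their sum `T` has mean `√m / 5`, while a characteristic function estimate gives
`E|T| ≥ 3√m / 5`. Since `ℓ z ≥ (|z| - z) / 2`, this yields `|v| √m ≤ 7`.

If `α * w 0 ≤ m * |v|`, raising `w 0` would lower the risk: the margins are only `O(√m)`, so the
gain when the first feature is right exceeds the cost of the probability `η` that it is wrong
(`strong_feature_loss_lt`). Thus `α * w 0 > m * |v|`, the first feature decides every sign, and the
error rate is the probability `η` that it is wrong. -/

/-! ### Products of finitely supported measures -/

lemma twoPoint_eq_sum (p a b : ℝ) :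
    twoPoint p a b = ∑ k : Bool,
      ENNReal.ofReal (cond k p (1 - p)) • Measure.dirac (cond k a b) := by
  simp [twoPoint]

lemma isProbabilityMeasure_twoPoint {p : ℝ} (h0 : 0 ≤ p) (h1 : p ≤ 1) (a b : ℝ) :
    IsProbabilityMeasure (twoPoint p a b) := by
  constructor
  simp [twoPoint, ← ENNReal.ofReal_add h0 (sub_nonneg.2 h1)]

lemma isFiniteMeasure_sum_dirac {κ α : Type*} [Fintype κ] [MeasurableSpace α]
    (c : κ → ℝ) (x : κ → α) :
    IsFiniteMeasure (∑ k, ENNReal.ofReal (c k) • Measure.dirac (x k)) := by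
  constructor
  simp [Measure.finsetSum_apply, ENNReal.sum_lt_top]

lemma pi_sum_dirac {ι κ : Type*} [Fintype ι] [DecidableEq ι] [Fintype κ]
    (c x : ι → κ → ℝ) (hc : ∀ i k, 0 ≤ c i k) :
    Measure.pi (fun i => ∑ k, ENNReal.ofReal (c i k) • Measure.dirac (x i k)) =
      ∑ s : ι → κ, ENNReal.ofReal (∏ i, c i (s i)) • Measure.dirac fun i => x i (s i) := by
  have := fun i => isFiniteMeasure_sum_dirac (c i) (x i)
  refine Measure.pi_eq fun t ht => ?_
  simp only [Measure.finsetSum_apply, Measure.smul_apply, smul_eq_mul]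
  rw [Finset.prod_univ_sum, Fintype.piFinset_univ]
  refine Finset.sum_congr rfl fun s _ => ?_
  rw [Finset.prod_mul_distrib, ENNReal.ofReal_prod_of_nonneg fun i _ => hc i _]
  congr 1
  rw [Measure.dirac_apply' _ (MeasurableSet.univ_pi ht)]
  simp_rw [Measure.dirac_apply' _ (ht _)]
  by_cases h : ∀ i, x i (s i) ∈ t i
  · simp [h, Set.indicator]
  · obtain ⟨i, hi⟩ := not_forall.1 h
    rw [Set.indicator_of_notMem (by simpa using h),
      Finset.prod_eq_zero (Finset.mem_univ i) (Set.indicator_of_notMem hi _)]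

lemma prod_sum_dirac {κ κ' α β : Type*} [Fintype κ] [Fintype κ'] [MeasurableSpace α]
    [MeasurableSpace β] (c : κ → ℝ) (x : κ → α) (d : κ' → ℝ) (y : κ' → β)
    (hc : ∀ k, 0 ≤ c k) :
    (∑ k, ENNReal.ofReal (c k) • Measure.dirac (x k)).prod
        (∑ k, ENNReal.ofReal (d k) • Measure.dirac (y k)) =
      ∑ r : κ × κ', ENNReal.ofReal (c r.1 * d r.2) • Measure.dirac (x r.1, y r.2) := by
  have := isFiniteMeasure_sum_dirac c x
  have := isFiniteMeasure_sum_dirac d y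
  refine Measure.prod_eq fun s t hs ht => ?_
  simp only [Measure.finsetSum_apply, Measure.smul_apply, smul_eq_mul, Finset.sum_mul_sum,
    Fintype.sum_prod_type]
  refine Finset.sum_congr rfl fun k _ => Finset.sum_congr rfl fun l _ => ?_
  rw [Measure.dirac_apply' _ (hs.prod ht), Measure.dirac_apply' _ hs, Measure.dirac_apply' _ ht,
    ENNReal.ofReal_mul (hc k), Set.indicator_prod_one]
  ring

lemma integral_finsetSum_dirac {κ α : Type*} [Fintype κ] [MeasurableSpace α] [MeasurableSingletonClass α]
    (c : κ → ℝ) (hc : ∀ k, 0 ≤ c k) (x : κ → α) (f : α → ℝ) :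
    ∫ a, f a ∂(∑ k, ENNReal.ofReal (c k) • Measure.dirac (x k)) = ∑ k, c k * f (x k) := by
  rw [integral_finsetSum_measure fun k _ => (integrable_dirac (by simp)).smul_measure (by simp)]
  simp [integral_smul_measure, hc]

lemma integrable_finsetSum_dirac {κ α : Type*} [Fintype κ] [MeasurableSpace α]
    [MeasurableSingletonClass α] (c : κ → ℝ) (x : κ → α) (f : α → ℝ) :
    Integrable f (∑ k, ENNReal.ofReal (c k) • Measure.dirac (x k)) :=
  integrable_finsetSum_measure.2
    fun k _ => (integrable_dirac (by simp)).smul_measure (by simp)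

/-! ### The dropout criterion as a finite sum -/

/-- The logistic risk of a linear predictor under independent features with finitely many values:
feature `i` takes the value `x i k` with probability `p i k`. -/
noncomputable def finiteRisk {ι κ : Type*} [Fintype ι] [DecidableEq ι] [Fintype κ] (p x : ι → κ → ℝ)
    (w : ι → ℝ) : ℝ :=
  ∑ s : ι → κ, (∏ i, p i (s i)) * logisticLoss (∑ i, w i * x i (s i))

/-- The probability that a feature agrees with the label. -/
noncomputable def agreeProb {n : ℕ} (β η : ℝ) (i : Fin n) : ℝ := if (i : ℕ) = 0 then 1 - η else 1 / 2 + β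

/-- The magnitude of a feature. -/
noncomputable def featureScale {n : ℕ} (α : ℝ) (i : Fin n) : ℝ := if (i : ℕ) = 0 then α else 1

/-- The probability that a feature agrees (or not) with the label and is kept (or dropped). -/
noncomputable def dropoutProb {n : ℕ} (β η : ℝ) (i : Fin n) (k : Bool × Bool) : ℝ :=
  cond k.1 (agreeProb β η i) (1 - agreeProb β η i) * (1 / 2)

/-- The value of label times feature under dropout. -/
noncomputable def dropoutValue {n : ℕ} (α : ℝ) (i : Fin n) (k : Bool × Bool) : ℝ :=
  cond k.2 (cond k.1 2 (-2) * featureScale α i) 0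

lemma featureLaw_eq_twoPoint (α β η y : ℝ) {n : ℕ} (i : Fin n) :
    featureLaw α β η y i =
      twoPoint (agreeProb β η i) (featureScale α i * y) (-(featureScale α i * y)) := by
  unfold featureLaw agreeProb featureScale
  split_ifs <;> simp

lemma sourceGiven_prod_dropoutNoise {n : ℕ} {α β η : ℝ} (hc : ∀ i : Fin n, 0 ≤ agreeProb β η i)
    (hc' : ∀ i : Fin n, agreeProb β η i ≤ 1) (y : ℝ) :
    (sourceGiven n α β η y).prod (dropoutNoise n (1 / 2)) =
      ∑ r : ((Fin n → Bool) × Unit) × (Fin n → Bool),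
        ENNReal.ofReal ((∏ i, cond (r.1.1 i) (agreeProb β η i) (1 - agreeProb β η i)) * 1 *
          ∏ i, cond (r.2 i) (1 / 2) (1 / 2)) •
        Measure.dirac (((fun i => cond (r.1.1 i) (featureScale α i * y) (-(featureScale α i * y))),
          y), fun i : Fin n => cond (r.2 i) 1 (-1)) := by
  have h0 : ∀ (i : Fin n) (k : Bool), 0 ≤ cond k (agreeProb β η i) (1 - agreeProb β η i) := by
    rintro i (_ | _)
    · simpa using hc' i
    · simpa using hc i
  -- A one-term sum, so that `prod_sum_dirac` also covers the label.
  have hy : Measure.dirac y = ∑ k : Unit, ENNReal.ofReal 1 • Measure.dirac y := by simp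
  unfold sourceGiven dropoutNoise
  simp_rw [featureLaw_eq_twoPoint, twoPoint_eq_sum]
  rw [hy, pi_sum_dirac _ _ h0, pi_sum_dirac _ _ (by rintro i (_ | _) <;> norm_num),
    prod_sum_dirac _ _ _ _ fun s => Finset.prod_nonneg fun i _ => h0 i _, prod_sum_dirac]
  · norm_num
  · intro r
    rw [mul_one]
    exact Finset.prod_nonneg fun i _ => h0 i _

/-- The label enters each term only through `y * y = 1`, so the result does not depend on `y`. -/
lemma integral_sourceGiven_prod {n : ℕ} {α β η : ℝ} (hc : ∀ i : Fin n, 0 ≤ agreeProb β η i)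
    (hc' : ∀ i : Fin n, agreeProb β η i ≤ 1) {y : ℝ} (hy : y * y = 1) (w : Fin n → ℝ) :
    ∫ t, logisticLoss (t.1.2 * ∑ i, w i * (t.1.1 i + t.2 i * t.1.1 i))
        ∂((sourceGiven n α β η y).prod (dropoutNoise n (1 / 2))) =
      finiteRisk (dropoutProb β η) (dropoutValue α) w := by
  rw [sourceGiven_prod_dropoutNoise hc hc', integral_finsetSum_dirac]
  · unfold finiteRisk
    -- Pairs the agreement bit and the dropout bit of each feature.
    rw [← (Equiv.arrowProdEquivProdArrow (Fin n) (fun _ => Bool) fun _ => Bool).symm.sum_comp]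
    simp only [Fintype.sum_prod_type, Finset.univ_unique, Finset.sum_singleton, mul_one]
    refine Finset.sum_congr rfl fun s _ => Finset.sum_congr rfl fun r _ => ?_
    rw [← Finset.prod_mul_distrib]
    congr 1
    · refine Finset.prod_congr rfl fun i _ => ?_
      simp only [dropoutProb, Equiv.arrowProdEquivProdArrow_symm_apply]
      cases r i <;> rfl
    · congr 1
      rw [Finset.mul_sum]
      refine Finset.sum_congr rfl fun i _ => ?_
      simp only [dropoutValue, Equiv.arrowProdEquivProdArrow_symm_apply]
      cases r i <;> cases s i <;> simp only [cond_true, cond_false] <;>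
        first | ring1 | linear_combination (2 * w i * featureScale α i) * hy |
          linear_combination (-2 * w i * featureScale α i) * hy
  · intro r
    rw [mul_one]
    refine mul_nonneg (Finset.prod_nonneg fun i _ => ?_) (Finset.prod_nonneg fun i _ => ?_)
    · cases r.1.1 i
      · simpa using hc' i
      · simpa using hc i
    · cases r.2 i <;> norm_num

lemma dropoutCriterion_source {n : ℕ} {α β η : ℝ} (hc : ∀ i : Fin n, 0 ≤ agreeProb β η i)
    (hc' : ∀ i : Fin n, agreeProb β η i ≤ 1) (w : Fin n → ℝ) :
    dropoutCriterion (source n α β η) (1 / 2) w =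
      finiteRisk (dropoutProb β η) (dropoutValue α) w := by
  have h1 (i : Fin n) (y : ℝ) : IsProbabilityMeasure (featureLaw α β η y i) := by
    rw [featureLaw_eq_twoPoint]
    exact isProbabilityMeasure_twoPoint (hc i) (hc' i) _ _
  have : IsProbabilityMeasure (twoPoint (1 - 1 / 2) (1 / (1 - 1 / 2) - 1) (-1)) :=
    isProbabilityMeasure_twoPoint (by norm_num) (by norm_num) _ _
  have (y : ℝ) : IsProbabilityMeasure (sourceGiven n α β η y) := by
    unfold sourceGiven; infer_instance
  have : IsProbabilityMeasure (dropoutNoise n (1 / 2)) := by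
    unfold dropoutNoise; infer_instance
  have hint (y : ℝ) (f : ((Fin n → ℝ) × ℝ) × (Fin n → ℝ) → ℝ) :
      Integrable f ((sourceGiven n α β η y).prod (dropoutNoise n (1 / 2))) := by
    rw [sourceGiven_prod_dropoutNoise hc hc']
    exact integrable_finsetSum_dirac _ _ _
  unfold dropoutCriterion source
  rw [Measure.add_prod, Measure.prod_smul_left, Measure.prod_smul_left,
    integral_add_measure ((hint _ _).smul_measure (by simp)) ((hint _ _).smul_measure (by simp)),
    integral_smul_measure, integral_smul_measure, integral_sourceGiven_prod hc hc' (by norm_num),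
    integral_sourceGiven_prod hc hc' (by norm_num)]
  norm_num
  ring

/-! ### Convexity of the logistic loss -/

lemma logisticLoss_nonneg (z : ℝ) : 0 ≤ logisticLoss z :=
  Real.log_nonneg (by linarith [Real.exp_pos (-z)])

lemma neg_le_logisticLoss (z : ℝ) : -z ≤ logisticLoss z := by
  unfold logisticLoss
  rw [Real.le_log_iff_exp_le (by positivity)]
  linarith

lemma logisticLoss_zero : logisticLoss 0 = Real.log 2 := by
  norm_num [logisticLoss]

lemma continuous_logisticLoss : Continuous logisticLoss :=
  Continuous.log (by fun_prop) fun z => by positivity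

/-- The logistic loss lies above its tangents, in the form of an increment bound. -/
lemma logisticLoss_add_le (z d : ℝ) :
    logisticLoss (z + d) ≤ logisticLoss z - d / (1 + Real.exp (z + d)) := by
  unfold logisticLoss
  have hA : (0 : ℝ) < 1 + Real.exp (-z) := by positivity
  have hB : (0 : ℝ) < 1 + Real.exp (-(z + d)) := by positivity
  suffices h : d / (1 + Real.exp (z + d)) ≤
      Real.log ((1 + Real.exp (-z)) / (1 + Real.exp (-(z + d)))) by
    rw [Real.log_div hA.ne' hB.ne'] at h
    linarith
  rw [Real.le_log_iff_exp_le (by positivity)]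
  -- weighted arithmetic-geometric mean inequality
  set E := Real.exp (z + d) with hE
  have hE0 : 0 < E := Real.exp_pos _
  have h1 : Real.exp (-(z + d)) = E⁻¹ := by rw [Real.exp_neg]
  have h2 : Real.exp (-z) = Real.exp d * E⁻¹ := by
    rw [hE, ← Real.exp_neg, ← Real.exp_add]; congr 1; ring
  have key := convexOn_exp.2 (Set.mem_univ (0 : ℝ)) (Set.mem_univ d)
    (show 0 ≤ E / (1 + E) by positivity) (show 0 ≤ 1 / (1 + E) by positivity)
    (by field_simp; ring)
  simp only [smul_eq_mul, mul_zero, zero_add, Real.exp_zero, mul_one] at key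
  rw [h1, h2]
  calc Real.exp (d / (1 + E)) = Real.exp (1 / (1 + E) * d) := by congr 1; ring
    _ ≤ _ := key
    _ = _ := by field_simp; ring

/-- With `p = exp (-a / 2)` and `q = exp (-b / 2)` this is `(1 + p q)² < (1 + p²)(1 + q²)`, that is,
`0 < (p - q)²`. -/
lemma logisticLoss_midpoint_lt {a b : ℝ} (h : a ≠ b) :
    logisticLoss ((a + b) / 2) < (logisticLoss a + logisticLoss b) / 2 := by
  unfold logisticLoss
  have hA : (0 : ℝ) < 1 + Real.exp (-a) := by positivity
  have hB : (0 : ℝ) < 1 + Real.exp (-b) := by positivity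
  have hM : (0 : ℝ) < 1 + Real.exp (-((a + b) / 2)) := by positivity
  suffices h : Real.log ((1 + Real.exp (-((a + b) / 2))) ^ 2) <
      Real.log ((1 + Real.exp (-a)) * (1 + Real.exp (-b))) by
    rw [Real.log_pow, Real.log_mul hA.ne' hB.ne'] at h
    push_cast at h
    linarith
  apply Real.log_lt_log (by positivity)
  set p := Real.exp (-a / 2) with hp
  set q := Real.exp (-b / 2) with hq
  have h1 : Real.exp (-a) = p ^ 2 := by rw [hp, ← Real.exp_nat_mul]; congr 1; push_cast; ring
  have h2 : Real.exp (-b) = q ^ 2 := by rw [hq, ← Real.exp_nat_mul]; congr 1; push_cast; ring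
  have h3 : Real.exp (-((a + b) / 2)) = p * q := by rw [hp, hq, ← Real.exp_add]; congr 1; ring
  have hne : p ≠ q := by
    intro hpq
    have := Real.exp_injective hpq
    exact h (by linarith)
  rw [h1, h2, h3]
  nlinarith [sq_pos_of_ne_zero (sub_ne_zero.2 hne)]

lemma logisticLoss_midpoint_le (a b : ℝ) :
    logisticLoss ((a + b) / 2) ≤ (logisticLoss a + logisticLoss b) / 2 := by
  by_cases h : a = b
  · subst h; simp
  · exact (logisticLoss_midpoint_lt h).le

/-! ### Existence, uniqueness and symmetry of the minimizer -/

section finiteRisk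

variable {ι κ : Type*} [Fintype ι] [DecidableEq ι] [Fintype κ] {p x : ι → κ → ℝ}

lemma continuous_finiteRisk : Continuous (finiteRisk p x) := by
  unfold finiteRisk
  refine continuous_finsetSum _ fun s _ => continuous_const.mul (continuous_logisticLoss.comp ?_)
  fun_prop

lemma sum_prod_eq_one (hp1 : ∀ i, ∑ k, p i k = 1) : ∑ s : ι → κ, ∏ i, p i (s i) = 1 := by
  rw [← Fintype.piFinset_univ, ← Finset.prod_univ_sum]
  simp [hp1]

lemma finiteRisk_zero (hp1 : ∀ i, ∑ k, p i k = 1) : finiteRisk p x 0 = Real.log 2 := by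
  simp [finiteRisk, logisticLoss_zero, ← Finset.sum_mul, sum_prod_eq_one hp1]

/-- A coordinate of the predictor is controlled by the risk when its feature takes both signs. -/
lemma exists_mul_abs_le_finiteRisk (hp : ∀ i k, 0 < p i k) (h0 : ∀ i, ∃ k, x i k = 0) (i : ι)
    (hpos : ∃ k, 0 < x i k) (hneg : ∃ k, x i k < 0) :
    ∃ c > 0, ∀ w, c * |w i| ≤ finiteRisk p x w := by
  choose z hz using h0
  obtain ⟨k, hk⟩ := hpos
  obtain ⟨l, hl⟩ := hneg
  -- In this atom every feature but `i` is zero, so the margin is `w i * x i k`; all other terms of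
  -- the risk are nonnegative.
  have hatom (w : ι → ℝ) (k : κ) :
      (∏ j, p j (Function.update z i k j)) * (-(w i * x i k)) ≤ finiteRisk p x w := by
    have hsum : ∑ j, w j * x j (Function.update z i k j) = w i * x i k := by
      rw [Finset.sum_eq_single i]
      · simp
      · intro j _ hj
        simp [Function.update_of_ne hj, hz]
      · simp
    calc _ ≤ (∏ j, p j (Function.update z i k j)) *
          logisticLoss (∑ j, w j * x j (Function.update z i k j)) := by
            rw [hsum]
            exact mul_le_mul_of_nonneg_left (neg_le_logisticLoss _)
              (Finset.prod_nonneg fun j _ => (hp j _).le)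
      _ ≤ finiteRisk p x w :=
        Finset.single_le_sum (f := fun s : ι → κ => (∏ j, p j (s j)) * logisticLoss (∑ j, w j * x j (s j)))
          (fun s _ => mul_nonneg (Finset.prod_nonneg fun j _ => (hp j _).le)
            (logisticLoss_nonneg _)) (Finset.mem_univ _)
  have hP (k : κ) : 0 < ∏ j, p j (Function.update z i k j) := Finset.prod_pos fun j _ => hp j _
  refine ⟨min ((∏ j, p j (Function.update z i k j)) * x i k)
    ((∏ j, p j (Function.update z i l j)) * (-x i l)),
    lt_min (mul_pos (hP k) hk) (mul_pos (hP l) (by linarith)), fun w => ?_⟩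
  rcases le_total 0 (w i) with hw | hw
  · rw [abs_of_nonneg hw]
    exact (mul_le_mul_of_nonneg_right (min_le_right _ _) hw).trans
      ((le_of_eq (by ring)).trans (hatom w l))
  · rw [abs_of_nonpos hw]
    exact (mul_le_mul_of_nonneg_right (min_le_left _ _) (by linarith)).trans
      ((le_of_eq (by ring)).trans (hatom w k))

lemma exists_finiteRisk_minimizer (hp : ∀ i k, 0 < p i k) (h0 : ∀ i, ∃ k, x i k = 0)
    (hpos : ∀ i, ∃ k, 0 < x i k) (hneg : ∀ i, ∃ k, x i k < 0) :
    ∃ w, ∀ w', finiteRisk p x w ≤ finiteRisk p x w' := by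
  choose c hc hcw using fun i => exists_mul_abs_le_finiteRisk hp h0 i (hpos i) (hneg i)
  refine continuous_finiteRisk.exists_forall_le' 0 ?_
  -- Outside this box some coordinate bound forces the risk above its value at `0`.
  have hK : IsCompact (Set.univ.pi fun i => Set.Icc (-(finiteRisk p x 0 / c i))
      (finiteRisk p x 0 / c i)) := isCompact_univ_pi fun i => isCompact_Icc
  filter_upwards [hK.compl_mem_cocompact] with w hw
  by_contra! hlt
  refine hw fun i _ => ?_
  rw [Set.mem_Icc, ← abs_le, le_div_iff₀ (hc i), mul_comm]
  exact (hcw i w).trans hlt.le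

/-- Each term is midpoint convex. Strictness comes from the atom where only a coordinate with `w i ≠
w' i` is nonzero, so that the two margins differ. -/
lemma finiteRisk_midpoint_lt (hp : ∀ i k, 0 < p i k) (h0 : ∀ i, ∃ k, x i k = 0)
    (hpos : ∀ i, ∃ k, 0 < x i k) {w w' : ι → ℝ} (hw : w ≠ w') :
    finiteRisk p x (fun i => (w i + w' i) / 2) < (finiteRisk p x w + finiteRisk p x w') / 2 := by
  choose z hz using h0
  obtain ⟨i, hi⟩ := Function.ne_iff.1 hw
  obtain ⟨k, hk⟩ := hpos i
  have hmid (s : ι → κ) : ∑ j, (w j + w' j) / 2 * x j (s j) =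
      ((∑ j, w j * x j (s j)) + ∑ j, w' j * x j (s j)) / 2 := by
    rw [← Finset.sum_add_distrib, Finset.sum_div]
    exact Finset.sum_congr rfl fun j _ => by ring
  have hsum (w : ι → ℝ) : ∑ j, w j * x j (Function.update z i k j) = w i * x i k := by
    rw [Finset.sum_eq_single i]
    · simp
    · intro j _ hj
      simp [Function.update_of_ne hj, hz]
    · simp
  have hP (s : ι → κ) : 0 < ∏ j, p j (s j) := Finset.prod_pos fun j _ => hp j _
  unfold finiteRisk
  rw [← Finset.sum_add_distrib, Finset.sum_div]
  refine Finset.sum_lt_sum (fun s _ => ?_) ⟨Function.update z i k, Finset.mem_univ _, ?_⟩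
  · rw [hmid]
    nlinarith [hP s, logisticLoss_midpoint_le (∑ j, w j * x j (s j)) (∑ j, w' j * x j (s j))]
  · rw [hmid]
    have := logisticLoss_midpoint_lt (a := ∑ j, w j * x j (Function.update z i k j))
      (b := ∑ j, w' j * x j (Function.update z i k j))
      (by rw [hsum, hsum]; exact fun h => hi (mul_right_cancel₀ hk.ne' h))
    nlinarith [hP (Function.update z i k)]

lemma finiteRisk_minimizer_unique (hp : ∀ i k, 0 < p i k) (h0 : ∀ i, ∃ k, x i k = 0)
    (hpos : ∀ i, ∃ k, 0 < x i k) {w w' : ι → ℝ}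
    (hw : ∀ v, finiteRisk p x w ≤ finiteRisk p x v)
    (hw' : ∀ v, finiteRisk p x w' ≤ finiteRisk p x v) : w = w' := by
  by_contra hne
  have := finiteRisk_midpoint_lt hp h0 hpos hne
  linarith [hw fun i => (w i + w' i) / 2, hw' fun i => (w i + w' i) / 2]

lemma finiteRisk_comp_perm (σ : Equiv.Perm ι) (hσp : ∀ i, p (σ i) = p i)
    (hσx : ∀ i, x (σ i) = x i) (w : ι → ℝ) : finiteRisk p x (w ∘ σ) = finiteRisk p x w := by
  unfold finiteRisk
  refine Fintype.sum_equiv (σ.arrowCongr (Equiv.refl κ)) _ _ fun s => ?_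
  congr 1
  · exact Fintype.prod_equiv σ _ _ fun i => by simp [hσp]
  · congr 1
    exact Fintype.sum_equiv σ _ _ fun i => by simp [hσx]

/-- Exchangeable features get equal weights at the minimizer. -/
lemma finiteRisk_minimizer_apply_eq (hp : ∀ i k, 0 < p i k) (h0 : ∀ i, ∃ k, x i k = 0)
    (hpos : ∀ i, ∃ k, 0 < x i k) {w : ι → ℝ} (hw : ∀ v, finiteRisk p x w ≤ finiteRisk p x v)
    {i j : ι} (hpij : p i = p j) (hxij : x i = x j) : w i = w j := by
  have hinv {f : ι → κ → ℝ} (hf : f i = f j) (l : ι) : f (Equiv.swap i j l) = f l := by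
    rw [Equiv.swap_apply_def]
    split_ifs with h1 h2
    · rw [h1, hf]
    · rw [h2, hf]
    · rfl
  -- Swapping the two weights gives another minimizer, which must be the same one.
  have hsw : w ∘ Equiv.swap i j = w := by
    refine finiteRisk_minimizer_unique hp h0 hpos (fun v => ?_) hw
    rw [finiteRisk_comp_perm _ (hinv hpij) (hinv hxij)]
    exact hw v
  simpa using (congrFun hsw j)

end finiteRisk

/-! ### Sums of independent features -/

/-- Splitting off the first feature. -/
lemma finiteRisk_succ {m : ℕ} {κ : Type*} [Fintype κ] (p x : Fin (m + 1) → κ → ℝ)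
    (w : Fin (m + 1) → ℝ) :
    finiteRisk p x w = ∑ s : Fin m → κ, (∏ i, p i.succ (s i)) *
      ∑ k, p 0 k * logisticLoss (w 0 * x 0 k + ∑ i : Fin m, w i.succ * x i.succ (s i)) := by
  unfold finiteRisk
  rw [← (Fin.consEquiv fun _ => κ).sum_comp, Fintype.sum_prod_type_right]
  refine Finset.sum_congr rfl fun s _ => ?_
  rw [Finset.mul_sum]
  refine Finset.sum_congr rfl fun k _ => ?_
  simp only [Fin.consEquiv_apply, Fin.prod_univ_succ, Fin.sum_univ_succ, Fin.cons_zero,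
    Fin.cons_succ]
  ring

lemma sum_prod_mul_sum {κ : Type*} [Fintype κ] (p f : κ → ℝ) (hp : ∑ k, p k = 1) (m : ℕ) :
    ∑ s : Fin m → κ, (∏ i, p (s i)) * ∑ i, f (s i) = m * ∑ k, p k * f k := by
  induction m with
  | zero => simp
  | succ m ih =>
    have h1 : ∑ s : Fin m → κ, ∏ i, p (s i) = 1 := sum_prod_eq_one (p := fun _ => p) fun _ => hp
    rw [← (Fin.consEquiv fun _ => κ).sum_comp, Fintype.sum_prod_type]
    simp only [Fin.consEquiv_apply, Fin.prod_univ_succ, Fin.sum_univ_succ, Fin.cons_zero,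
      Fin.cons_succ]
    have h2 (k : κ) : ∑ s : Fin m → κ, p k * (∏ i, p (s i)) * (f k + ∑ i, f (s i)) =
        p k * f k + p k * (m * ∑ k, p k * f k) := by
      rw [← ih, Finset.mul_sum, ← mul_one (p k * f k), ← h1, Finset.mul_sum,
        ← Finset.sum_add_distrib]
      exact Finset.sum_congr rfl fun s _ => by ring
    simp_rw [h2]
    rw [Finset.sum_add_distrib, ← Finset.sum_mul, hp]
    push_cast
    ring

/-- The expected cosine of a sum of independent copies is bounded by a power of the modulus of the
characteristic function. -/
lemma sum_prod_mul_cos_le {κ : Type*} [Fintype κ] (p f : κ → ℝ) (t : ℝ) (m : ℕ) :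
    ∑ s : Fin m → κ, (∏ i, p (s i)) * Real.cos (t * ∑ i, f (s i)) ≤
      ‖∑ k, (p k : ℂ) * Complex.exp ((t * f k : ℝ) * Complex.I)‖ ^ m := by
  have h : ∑ s : Fin m → κ, ((∏ i, p (s i) : ℝ) : ℂ) *
      Complex.exp ((t * ∑ i, f (s i) : ℝ) * Complex.I) =
        (∑ k, (p k : ℂ) * Complex.exp ((t * f k : ℝ) * Complex.I)) ^ m := by
    have := Finset.prod_univ_sum (fun _ : Fin m => (Finset.univ : Finset κ))
      fun _ k => (p k : ℂ) * Complex.exp ((t * f k : ℝ) * Complex.I)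
    rw [Finset.prod_const, Finset.card_univ, Fintype.card_fin, Fintype.piFinset_univ] at this
    rw [this]
    refine Finset.sum_congr rfl fun s _ => ?_
    rw [Finset.prod_mul_distrib, ← Complex.exp_sum, ← Finset.sum_mul, Finset.mul_sum]
    push_cast
    rfl
  rw [← norm_pow, ← h]
  refine le_trans (le_of_eq ?_) (Complex.re_le_norm _)
  rw [Complex.re_sum]
  refine Finset.sum_congr rfl fun s _ => ?_
  rw [Complex.re_ofReal_mul, Complex.exp_ofReal_mul_I_re]

/-! ### The weak features -/

/-- The probability that a feature other than the first agrees (or not) with the label and is kept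
(or dropped). -/
noncomputable def weakProb (β : ℝ) (k : Bool × Bool) : ℝ :=
  cond k.1 (1 / 2 + β) (1 - (1 / 2 + β)) * (1 / 2)

/-- The value of label times feature under dropout, for a feature other than the first. -/
noncomputable def weakValue (k : Bool × Bool) : ℝ := cond k.2 (cond k.1 2 (-2)) 0

lemma sum_weakProb (β : ℝ) : ∑ k, weakProb β k = 1 := by
  simp [weakProb, Fintype.sum_prod_type]; ring

lemma sum_weakProb_mul_weakValue (β : ℝ) : ∑ k, weakProb β k * weakValue k = 2 * β := by
  simp [weakProb, weakValue, Fintype.sum_prod_type]; ring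

lemma abs_weakValue_le (k : Bool × Bool) : |weakValue k| ≤ 2 := by
  rcases k with ⟨_ | _, _ | _⟩ <;> norm_num [weakValue]

/-- The characteristic function is `(1 + cos 2t) / 2 + i β sin 2t`. -/
lemma norm_sq_weak_charFun (β t : ℝ) :
    ‖∑ k, (weakProb β k : ℂ) * Complex.exp ((t * weakValue k : ℝ) * Complex.I)‖ ^ 2 =
      Real.cos t ^ 2 * (Real.cos t ^ 2 + 4 * β ^ 2 * Real.sin t ^ 2) := by
  have hre : (∑ k, (weakProb β k : ℂ) * Complex.exp ((t * weakValue k : ℝ) * Complex.I)).re =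
      Real.cos t ^ 2 := by
    rw [Complex.re_sum]
    simp_rw [Complex.re_ofReal_mul, Complex.exp_ofReal_mul_I_re]
    simp only [Fintype.sum_prod_type, Fintype.sum_bool, weakProb, weakValue, cond_true, cond_false,
      mul_neg, mul_zero, Real.cos_neg, Real.cos_zero]
    rw [mul_comm t 2, Real.cos_two_mul]
    ring
  have him : (∑ k, (weakProb β k : ℂ) * Complex.exp ((t * weakValue k : ℝ) * Complex.I)).im =
      2 * β * Real.sin t * Real.cos t := by
    rw [Complex.im_sum]
    simp_rw [Complex.im_ofReal_mul, Complex.exp_ofReal_mul_I_im]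
    simp only [Fintype.sum_prod_type, Fintype.sum_bool, weakProb, weakValue, cond_true, cond_false,
      mul_neg, mul_zero, Real.sin_neg, Real.sin_zero]
    rw [mul_comm t 2, Real.sin_two_mul]
    ring
  rw [Complex.sq_norm, Complex.normSq_apply, hre, him]
  ring

/-- For `t = 1 / √m` the squared modulus is `(1 - sin² t)(1 - (1 - 4β²) sin² t)`, at most `exp (-1.9
t²)`. Its `m`-th power is at most `exp (-1.9) ≤ (2/5)²`. -/
lemma norm_weak_charFun_pow_le {m : ℕ} (hm : 99 ≤ m) {β : ℝ} (hβ : β = 1 / (10 * √m)) :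
    ‖∑ k, (weakProb β k : ℂ) * Complex.exp ((1 / √m * weakValue k : ℝ) * Complex.I)‖ ^ m ≤
      2 / 5 := by
  have hm' : (99 : ℝ) ≤ m := by exact_mod_cast hm
  have hs : 0 < √(m : ℝ) := Real.sqrt_pos.2 (by linarith)
  have hss : √(m : ℝ) ^ 2 = m := Real.sq_sqrt (by linarith)
  have hs9 : 9 ≤ √(m : ℝ) := Real.le_sqrt_of_sq_le (by linarith)
  set t : ℝ := 1 / √m with ht
  have ht0 : 0 < t := by positivity
  have ht2 : m * t ^ 2 = 1 := by rw [ht, div_pow, hss]; field_simp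
  have ht2' : t ^ 2 ≤ 1 / 99 := by
    rw [ht, div_pow, hss, one_pow]; exact one_div_le_one_div_of_le (by norm_num) hm'
  have hβ2 : 4 * β ^ 2 ≤ 1 / 1000 := by
    have : β = t / 10 := by rw [hβ, ht]; field_simp
    rw [this]; linarith
  have hsin : 99 / 100 * t ≤ Real.sin t := by
    have := Real.sin_gt_sub_cube ht0
    nlinarith
  have hsin2 : 98 / 100 * t ^ 2 ≤ Real.sin t ^ 2 := by
    nlinarith
  have hcos : Real.cos t ^ 2 = 1 - Real.sin t ^ 2 := Real.cos_sq' t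
  have hnorm : ‖∑ k, (weakProb β k : ℂ) * Complex.exp ((t * weakValue k : ℝ) * Complex.I)‖ ^ 2 ≤
      Real.exp (-(19 / 10) * t ^ 2) := by
    rw [norm_sq_weak_charFun]
    calc _ ≤ Real.exp (-Real.sin t ^ 2) * Real.exp (-(999 / 1000) * Real.sin t ^ 2) := by
          gcongr
          · linarith [Real.add_one_le_exp (-Real.sin t ^ 2)]
          · nlinarith [Real.add_one_le_exp (-(999 / 1000) * Real.sin t ^ 2),
              sq_nonneg (Real.sin t)]
      _ ≤ _ := by
        rw [← Real.exp_add, Real.exp_le_exp]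
        nlinarith [sq_nonneg t]
  have hexp : Real.exp (-(19 / 10)) ≤ (2 / 5) ^ 2 := by
    have h1 := Real.exp_one_gt_d9
    have h2 := Real.quadratic_le_exp_of_nonneg (show (0 : ℝ) ≤ 9 / 10 by norm_num)
    have h3 : Real.exp (19 / 10) = Real.exp 1 * Real.exp (9 / 10) := by
      rw [← Real.exp_add]; norm_num
    rw [Real.exp_neg, inv_le_comm₀ (Real.exp_pos _) (by norm_num), h3]
    nlinarith
  refine (sq_le_sq₀ (by positivity) (by norm_num)).1 ?_
  calc _ = (‖∑ k, (weakProb β k : ℂ) * Complex.exp ((t * weakValue k : ℝ) * Complex.I)‖ ^ 2) ^ m :=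
        by rw [← pow_mul, ← pow_mul, mul_comm]
    _ ≤ Real.exp (-(19 / 10) * t ^ 2) ^ m := by gcongr
    _ = Real.exp (-(19 / 10)) := by
      rw [← Real.exp_nat_mul]; congr 1; linear_combination (-(19 / 10)) * ht2
    _ ≤ _ := hexp

/-- A lower bound for the first absolute moment of the sum of the weak features. -/
lemma le_sum_prod_mul_abs {m : ℕ} (hm : 99 ≤ m) {β : ℝ} (hβ : β = 1 / (10 * √m))
    (hp : ∀ k, 0 < weakProb β k) :
    3 / 5 * √m ≤ ∑ s : Fin m → Bool × Bool,
      (∏ i, weakProb β (s i)) * |∑ i, weakValue (s i)| := by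
  have hs : 0 < √(m : ℝ) := Real.sqrt_pos.2 (by exact_mod_cast (by omega : 0 < m))
  have h1 : ∑ s : Fin m → Bool × Bool, ∏ i, weakProb β (s i) = 1 :=
    sum_prod_eq_one (p := fun _ => weakProb β) fun _ => sum_weakProb β
  have hcos := (sum_prod_mul_cos_le (weakProb β) weakValue (1 / √m) m).trans
    (norm_weak_charFun_pow_le hm hβ)
  have hle : ∑ s : Fin m → Bool × Bool, ((∏ i, weakProb β (s i)) -
      (∏ i, weakProb β (s i)) * Real.cos (1 / √m * ∑ i, weakValue (s i))) ≤
      ∑ s : Fin m → Bool × Bool,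
        1 / √m * ((∏ i, weakProb β (s i)) * |∑ i, weakValue (s i)|) := by
    refine Finset.sum_le_sum fun s _ => ?_
    -- `1 - cos u ≤ |u|`: averaging turns the bound `2/5` on the mean cosine into the constant
    -- `3/5`.
    have h := (abs_le.1 (Real.abs_cos_sub_cos_le (1 / √m * ∑ i, weakValue (s i)) 0)).1
    rw [Real.cos_zero, sub_zero, abs_mul, abs_of_pos (by positivity : 0 < 1 / √(m : ℝ))] at h
    nlinarith [Finset.prod_pos fun i (_ : i ∈ Finset.univ) => hp (s i)]
  rw [Finset.sum_sub_distrib, h1, ← Finset.mul_sum, one_div, inv_mul_eq_div, le_div_iff₀ hs] at hle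
  rw [one_div] at hcos
  nlinarith

/-- Absolute moment `3/5` against mean `1/5`, both times `√m`, give `|v| √m / 5 ≤ 2 log 2`, and `10
log 2 < 7`. -/
lemma weak_weight_bound {m : ℕ} (hm : 99 ≤ m) {β : ℝ} (hβ : β = 1 / (10 * √m))
    (hp : ∀ k, 0 < weakProb β k) {v : ℝ}
    (hv : ∑ s : Fin m → Bool × Bool, (∏ i, weakProb β (s i)) *
      logisticLoss (v * ∑ i, weakValue (s i)) ≤ 2 * Real.log 2) : |v| * √m ≤ 7 := by
  have hs : 0 < √(m : ℝ) := Real.sqrt_pos.2 (by exact_mod_cast (by omega : 0 < m))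
  have hss : √(m : ℝ) * √m = m := Real.mul_self_sqrt (Nat.cast_nonneg m)
  have habs := le_sum_prod_mul_abs hm hβ hp
  have hmean := sum_prod_mul_sum (weakProb β) weakValue (sum_weakProb β) m
  rw [sum_weakProb_mul_weakValue] at hmean
  have hmean' : (m : ℝ) * (2 * β) = √m / 5 := by
    rw [hβ]; nth_rewrite 1 [← hss]; field_simp; norm_num
  rw [hmean'] at hmean
  have hlow : |v| / 2 * ∑ s : Fin m → Bool × Bool,
      (∏ i, weakProb β (s i)) * |∑ i, weakValue (s i)| - v / 2 * ∑ s : Fin m → Bool × Bool,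
      (∏ i, weakProb β (s i)) * ∑ i, weakValue (s i) ≤ 2 * Real.log 2 := by
    refine le_trans ?_ hv
    rw [Finset.mul_sum, Finset.mul_sum, ← Finset.sum_sub_distrib]
    refine Finset.sum_le_sum fun s _ => ?_
    have hP := (Finset.prod_pos fun i (_ : i ∈ Finset.univ) => hp (s i)).le
    set T := ∑ i, weakValue (s i)
    -- The left side is `max 0 (-(v * T))`.
    have h : |v| * |T| / 2 - v * T / 2 ≤ logisticLoss (v * T) := by
      rw [← abs_mul]
      rcases abs_cases (v * T) with ⟨h, _⟩ | ⟨h, _⟩ <;> rw [h]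
      · linarith [logisticLoss_nonneg (v * T)]
      · linarith [neg_le_logisticLoss (v * T)]
    nlinarith
  rw [hmean] at hlow
  have hlog := Real.log_two_lt_d9
  nlinarith [mul_le_mul_of_nonneg_left habs (abs_nonneg v), le_abs_self v]

/-! ### Domination by the first feature -/

lemma dropoutProb_pos {n : ℕ} {β η : ℝ} (hc : ∀ i : Fin n, 0 < agreeProb β η i)
    (hc' : ∀ i : Fin n, agreeProb β η i < 1) (i : Fin n) (k : Bool × Bool) :
    0 < dropoutProb β η i k := by
  rcases k with ⟨_ | _, _⟩
  · simpa [dropoutProb] using hc' i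
  · simpa [dropoutProb] using hc i

lemma sum_dropoutProb {n : ℕ} (β η : ℝ) (i : Fin n) : ∑ k, dropoutProb β η i k = 1 := by
  simp [dropoutProb, Fintype.sum_prod_type]; ring

lemma dropoutProb_succ {m : ℕ} (β η : ℝ) (i : Fin m) : dropoutProb β η i.succ = weakProb β := by
  funext k; simp [dropoutProb, weakProb, agreeProb]

lemma dropoutValue_succ {m : ℕ} (α : ℝ) (i : Fin m) : dropoutValue α i.succ = weakValue := by
  funext k; simp [dropoutValue, weakValue, featureScale]

lemma featureScale_pos {n : ℕ} {α : ℝ} (hα : 0 < α) (i : Fin n) : 0 < featureScale α i := by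
  unfold featureScale; split_ifs <;> positivity

/-- The risk as a function of the first weight and a common value of the other weights. -/
lemma finiteRisk_dropout_eq {m : ℕ} (α β η : ℝ) {w : Fin (m + 1) → ℝ} {v : ℝ}
    (hw : ∀ i : Fin m, w i.succ = v) :
    finiteRisk (dropoutProb β η) (dropoutValue α) w =
      ∑ s : Fin m → Bool × Bool, (∏ i, weakProb β (s i)) *
        ((1 - η) / 2 * logisticLoss (2 * α * w 0 + v * ∑ i, weakValue (s i)) +
          η / 2 * logisticLoss (-(2 * α * w 0) + v * ∑ i, weakValue (s i)) +
          1 / 2 * logisticLoss (v * ∑ i, weakValue (s i))) := by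
  rw [finiteRisk_succ]
  refine Finset.sum_congr rfl fun s _ => ?_
  simp_rw [dropoutProb_succ, dropoutValue_succ, hw, ← Finset.mul_sum]
  congr 1
  set S := v * ∑ i, weakValue (s i)
  simp only [Fintype.sum_prod_type, Fintype.sum_bool, dropoutProb, dropoutValue, agreeProb,
    featureScale, Fin.val_zero, if_true, cond_true, cond_false, mul_zero, zero_add]
  rw [show w 0 * (2 * α) = 2 * α * w 0 by ring, show w 0 * (-2 * α) = -(2 * α * w 0) by ring]
  ring

/-- By convexity the correct branch gains at least `δ / (1 + exp (2 * M + δ))`, its margin staying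
below `2 * M + δ`. The wrong branch loses less than `δ`, as the slope of the loss is below `1` in
modulus. The bound on `η` says exactly that `η * (1 + exp (2 * M + δ)) ≤ 1 - η`. -/
lemma strong_feature_loss_lt {η U S M δ : ℝ} (hη : 0 < η) (hS : |S| ≤ M) (hU : U ≤ M) (hδ : 0 < δ)
    (hηM : η ≤ 1 / (2 + Real.exp (2 * M + δ))) :
    (1 - η) / 2 * logisticLoss (U + δ + S) + η / 2 * logisticLoss (-(U + δ) + S) <
      (1 - η) / 2 * logisticLoss (U + S) + η / 2 * logisticLoss (-U + S) := by
  have hE := Real.exp_pos (2 * M + δ)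
  rw [le_div_iff₀ (by positivity)] at hηM
  have h1 := logisticLoss_add_le (U + S) δ
  have h2 := logisticLoss_add_le (-U + S) (-δ)
  rw [show U + S + δ = U + δ + S by ring] at h1
  rw [show -U + S + -δ = -(U + δ) + S by ring] at h2
  have h3 : δ / (1 + Real.exp (2 * M + δ)) ≤ δ / (1 + Real.exp (U + δ + S)) := by
    have : Real.exp (U + δ + S) ≤ Real.exp (2 * M + δ) :=
      Real.exp_le_exp.2 (by linarith [(abs_le.1 hS).2])
    gcongr
  have h4 : δ / (1 + Real.exp (-(U + δ) + S)) < δ :=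
    div_lt_self hδ (by linarith [Real.exp_pos (-(U + δ) + S)])
  have h5 : η * δ ≤ (1 - η) * (δ / (1 + Real.exp (2 * M + δ))) := by
    rw [mul_div_assoc', le_div_iff₀ (by positivity)]
    nlinarith
  have h6 : 0 ≤ 1 - η := by nlinarith
  have h7 : (1 - η) * logisticLoss (U + δ + S) ≤
      (1 - η) * (logisticLoss (U + S) - δ / (1 + Real.exp (2 * M + δ))) :=
    mul_le_mul_of_nonneg_left (by linarith) h6
  have h8 : η * logisticLoss (-(U + δ) + S) < η * (logisticLoss (-U + S) + δ) :=
    mul_lt_mul_of_pos_left (by rw [neg_div] at h2; linarith) hη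
  linarith

/-- At the minimizer the first feature outweighs all others together. -/
lemma minimizer_strong_feature_dominates {m : ℕ} (hm : 99 ≤ m) {α β η : ℝ} (hα : 0 < α)
    (hβ : β = 1 / (10 * √m)) (hη₀ : 0 < η) (hη : η ≤ 1 / (2 + Real.exp (54 * √((m : ℝ) + 1))))
    (hc : ∀ i : Fin (m + 1), 0 < agreeProb β η i)
    (hc' : ∀ i : Fin (m + 1), agreeProb β η i < 1) {w : Fin (m + 1) → ℝ} {v : ℝ}
    (hw : ∀ i : Fin m, w i.succ = v)
    (hmin : ∀ w' : Fin (m + 1) → ℝ, finiteRisk (dropoutProb β η) (dropoutValue α) w ≤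
      finiteRisk (dropoutProb β η) (dropoutValue α) w') : m * |v| < α * w 0 := by
  have hp (k) : 0 < weakProb β k := by
    rw [← dropoutProb_succ β η (⟨0, by omega⟩ : Fin m)]
    exact dropoutProb_pos hc hc' _ k
  have hP (s : Fin m → Bool × Bool) : 0 < ∏ i, weakProb β (s i) :=
    Finset.prod_pos fun i _ => hp _
  have hη1 : η < 1 := by simpa [agreeProb] using hc 0
  have hv : |v| * √m ≤ 7 := by
    refine weak_weight_bound hm hβ hp ?_
    have h := hmin 0
    rw [finiteRisk_zero (sum_dropoutProb β η), finiteRisk_dropout_eq α β η hw] at h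
    -- Only the event that the first feature is dropped is retained.
    have hle : ∑ s : Fin m → Bool × Bool, 1 / 2 * ((∏ i, weakProb β (s i)) *
        logisticLoss (v * ∑ i, weakValue (s i))) ≤ Real.log 2 := by
      refine le_trans (Finset.sum_le_sum fun s _ => ?_) h
      have h1 := mul_nonneg (by linarith : 0 ≤ (1 - η) / 2)
        (logisticLoss_nonneg (2 * α * w 0 + v * ∑ i, weakValue (s i)))
      have h2 := mul_nonneg (by linarith : 0 ≤ η / 2)
        (logisticLoss_nonneg (-(2 * α * w 0) + v * ∑ i, weakValue (s i)))
      rw [mul_left_comm]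
      exact mul_le_mul_of_nonneg_left (by linarith) (hP s).le
    rw [← Finset.mul_sum] at hle
    linarith
  by_contra! hlt
  have hss : √(m : ℝ) * √m = m := Real.mul_self_sqrt (Nat.cast_nonneg m)
  have hmono : √(m : ℝ) ≤ √((m : ℝ) + 1) := Real.sqrt_le_sqrt (by linarith)
  have hs : 0 < √(m : ℝ) := Real.sqrt_pos.2 (by exact_mod_cast (by omega : 0 < m))
  have hmv : m * |v| ≤ 7 * √m := by
    calc m * |v| = |v| * √m * √m := by rw [mul_assoc, hss, mul_comm]
      _ ≤ 7 * √m := mul_le_mul_of_nonneg_right hv hs.le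
  -- Chosen so that `2 * M + δ` is the exponent in the bound on `η`, where `M = 2 * (m * |v|)`
  -- bounds the weak margin. It is positive because `2 * M ≤ 28 * √m`.
  set δ := 54 * √((m : ℝ) + 1) - 2 * (2 * (m * |v|)) with hδ
  have hδ0 : 0 < δ := by linarith
  have hw' : ∀ i : Fin m, Function.update w 0 (w 0 + δ / (2 * α)) i.succ = v := fun i => by
    rw [Function.update_of_ne (Fin.succ_ne_zero i), hw]
  refine (hmin (Function.update w 0 (w 0 + δ / (2 * α)))).not_gt ?_
  rw [finiteRisk_dropout_eq α β η hw, finiteRisk_dropout_eq α β η hw', Function.update_self]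
  have hU : 2 * α * (w 0 + δ / (2 * α)) = 2 * α * w 0 + δ := by field_simp
  rw [hU]
  refine Finset.sum_lt_sum_of_nonempty Finset.univ_nonempty fun s _ => ?_
  refine mul_lt_mul_of_pos_left (add_lt_add_left (strong_feature_loss_lt (M := 2 * (m * |v|)) hη₀
    ?_ (by linarith) hδ0 ?_) _) (hP s)
  · rw [abs_mul]
    have h := (Finset.abs_sum_le_sum_abs (fun i => weakValue (s i)) Finset.univ).trans
      (Finset.sum_le_card_nsmul _ _ 2 fun i _ => abs_weakValue_le (s i))
    rw [Finset.card_univ, Fintype.card_fin, nsmul_eq_mul] at h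
    nlinarith [abs_nonneg v]
  · rwa [hδ, add_sub_cancel]

/-! ### Signs and the error rate -/

lemma ae_abs_eq_source {n : ℕ} {α β η : ℝ} (hα : 0 < α)
    (hc : ∀ i : Fin n, 0 ≤ agreeProb β η i) (hc' : ∀ i : Fin n, agreeProb β η i ≤ 1) :
    ∀ᵐ z ∂(source n α β η), ∀ i, |z.1 i| = featureScale α i := by
  have h1 (i : Fin n) (y : ℝ) : IsProbabilityMeasure (featureLaw α β η y i) := by
    rw [featureLaw_eq_twoPoint]
    exact isProbabilityMeasure_twoPoint (hc i) (hc' i) _ _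
  have hmeas (i : Fin n) : MeasurableSet {t : ℝ | |t| = featureScale α i} :=
    measurableSet_eq_fun (by fun_prop) (by fun_prop)
  have key (y : ℝ) (hy : |y| = 1) :
      ∀ᵐ z ∂(sourceGiven n α β η y), ∀ i, |z.1 i| = featureScale α i := by
    refine ae_all_iff.2 fun i => ?_
    have hi : ∀ᵐ t ∂(featureLaw α β η y i), |t| = featureScale α i := by
      rw [featureLaw_eq_twoPoint, twoPoint, ae_add_measure_iff]
      constructor <;> refine Measure.ae_smul_measure ?_ _ <;>
        rw [ae_dirac_iff (hmeas i)] <;> simp [abs_mul, hy, (featureScale_pos hα i).le]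
    exact Measure.quasiMeasurePreserving_fst.ae
      ((measurePreserving_eval (featureLaw α β η y) i).quasiMeasurePreserving.ae hi)
  unfold source
  rw [ae_add_measure_iff]
  exact ⟨Measure.ae_smul_measure (key 1 (by simp)) _, Measure.ae_smul_measure (key (-1) (by simp)) _⟩

lemma source_real_sign_ne {m : ℕ} {α β η : ℝ} (hα : 0 < α) (hη : 0 ≤ η)
    (hc : ∀ i : Fin (m + 1), 0 ≤ agreeProb β η i)
    (hc' : ∀ i : Fin (m + 1), agreeProb β η i ≤ 1) :
    (source (m + 1) α β η).real {z | Real.sign (z.1 0) ≠ z.2} = η := by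
  have h1 (i : Fin (m + 1)) (y : ℝ) : IsProbabilityMeasure (featureLaw α β η y i) := by
    rw [featureLaw_eq_twoPoint]
    exact isProbabilityMeasure_twoPoint (hc i) (hc' i) _ _
  have hsign : Measurable Real.sign := by
    unfold Real.sign
    exact Measurable.ite measurableSet_Iio measurable_const
      (Measurable.ite measurableSet_Ioi measurable_const measurable_const)
  have hmeas : MeasurableSet {z : (Fin (m + 1) → ℝ) × ℝ | Real.sign (z.1 0) ≠ z.2} :=
    (measurableSet_eq_fun (hsign.comp (by fun_prop)) measurable_snd).compl
  have key (y : ℝ) (hy : y = 1 ∨ y = -1) :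
      sourceGiven (m + 1) α β η y {z | Real.sign (z.1 0) ≠ z.2} = ENNReal.ofReal η := by
    have hm' : MeasurableSet {t : ℝ | Real.sign t ≠ y} :=
      (measurableSet_eq_fun hsign measurable_const).compl
    unfold sourceGiven
    rw [Measure.prod_dirac, Measure.map_apply (by fun_prop) hmeas]
    refine ((measurePreserving_eval (featureLaw α β η y) 0).measure_preimage
      hm'.nullMeasurableSet).trans ?_
    rw [featureLaw, if_pos (Fin.val_zero _), twoPoint, Measure.add_apply, Measure.smul_apply,
      Measure.smul_apply, Measure.dirac_apply' _ hm', Measure.dirac_apply' _ hm']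
    rcases hy with rfl | rfl
    · norm_num [Set.indicator, Real.sign_of_pos hα, Real.sign_of_neg (neg_neg_of_pos hα)]
    · norm_num [Set.indicator, Real.sign_of_pos hα, Real.sign_of_neg (neg_neg_of_pos hα)]
  rw [Measure.real, source, Measure.add_apply, Measure.smul_apply, Measure.smul_apply,
    key 1 (Or.inl rfl), key (-1) (Or.inr rfl), smul_eq_mul, ← add_mul, ENNReal.add_halves, one_mul,
    ENNReal.toReal_ofReal hη]

lemma sign_mul_of_pos {a b : ℝ} (h : 0 < a) : Real.sign (a * b) = Real.sign b := by
  rcases lt_trichotomy b 0 with hb | rfl | hb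
  · rw [Real.sign_of_neg hb, Real.sign_of_neg (mul_neg_of_pos_of_neg h hb)]
  · rw [mul_zero]
  · rw [Real.sign_of_pos hb, Real.sign_of_pos (mul_pos h hb)]

lemma sign_add_eq_of_abs_lt {a b : ℝ} (h : |b| < |a|) : Real.sign (a + b) = Real.sign a := by
  rw [abs_lt] at h
  rcases abs_cases a with ⟨ha, _⟩ | ⟨ha, _⟩ <;> rw [ha] at h
  · rw [Real.sign_of_pos (by linarith), Real.sign_of_pos (by linarith)]
  · rw [Real.sign_of_neg (by linarith), Real.sign_of_neg (by linarith)]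

theorem theoremt (n : ℕ) (hn : 100 ≤ n) (α β η : ℝ) (hα : 0 < α)
    (hβ : β = 1 / (10 * Real.sqrt ((n : ℝ) - 1)))
    (hη₀ : 0 < η) (hη : η ≤ 1 / (2 + Real.exp (54 * Real.sqrt (n : ℝ)))) :
    (∃! w : Fin n → ℝ, IsDropoutMinimizer (source n α β η) (1 / 2) w) ∧
      ∀ w : Fin n → ℝ, IsDropoutMinimizer (source n α β η) (1 / 2) w →
        (∀ᵐ z ∂(source n α β η),
          Real.sign (∑ i, w i * z.1 i) = Real.sign (z.1 ⟨0, by omega⟩)) ∧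
        errorRate (source n α β η) w = η := by
  obtain ⟨m, rfl⟩ : ∃ m, n = m + 1 := ⟨n - 1, by omega⟩
  have hm : 99 ≤ m := by omega
  have hm' : (99 : ℝ) ≤ m := by exact_mod_cast hm
  push_cast at hβ hη
  rw [add_sub_cancel_right] at hβ
  have hs9 : 9 ≤ √(m : ℝ) := Real.le_sqrt_of_sq_le (by linarith)
  have hβ0 : 0 < β := by rw [hβ]; positivity
  have hβ1 : β < 1 / 2 := by
    rw [hβ]; exact one_div_lt_one_div_of_lt (by norm_num) (by linarith)
  have hη1 : η < 1 := hη.trans_lt (by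
    rw [div_lt_one (by positivity)]; linarith [Real.exp_pos (54 * √((m : ℝ) + 1))])
  have hc (i : Fin (m + 1)) : 0 < agreeProb β η i := by unfold agreeProb; split_ifs <;> linarith
  have hc' (i : Fin (m + 1)) : agreeProb β η i < 1 := by unfold agreeProb; split_ifs <;> linarith
  have hiff (w : Fin (m + 1) → ℝ) : IsDropoutMinimizer (source (m + 1) α β η) (1 / 2) w ↔
      ∀ w' : Fin (m + 1) → ℝ, finiteRisk (dropoutProb β η) (dropoutValue α) w ≤
        finiteRisk (dropoutProb β η) (dropoutValue α) w' := by
    unfold IsDropoutMinimizer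
    simp_rw [dropoutCriterion_source (fun i => (hc i).le) fun i => (hc' i).le]
  have hp := dropoutProb_pos hc hc'
  have h0 (i : Fin (m + 1)) : ∃ k, dropoutValue α i k = 0 := ⟨(true, false), rfl⟩
  have hpos (i : Fin (m + 1)) : ∃ k, 0 < dropoutValue α i k :=
    ⟨(true, true), by simpa [dropoutValue] using featureScale_pos hα i⟩
  have hneg (i : Fin (m + 1)) : ∃ k, dropoutValue α i k < 0 :=
    ⟨(false, true), by simpa [dropoutValue] using featureScale_pos hα i⟩
  refine ⟨?_, fun w hw => ?_⟩
  · obtain ⟨w, hw⟩ := exists_finiteRisk_minimizer hp h0 hpos hneg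
    exact ⟨w, (hiff w).2 hw, fun w' hw' =>
      finiteRisk_minimizer_unique hp h0 hpos ((hiff w').1 hw') hw⟩
  rw [hiff] at hw
  have hv : ∀ i : Fin m, w i.succ = w (⟨0, by omega⟩ : Fin m).succ := fun i =>
    finiteRisk_minimizer_apply_eq hp h0 hpos hw (by simp only [dropoutProb_succ])
      (by simp only [dropoutValue_succ])
  set v := w (⟨0, by omega⟩ : Fin m).succ
  have hdom := minimizer_strong_feature_dominates hm hα hβ hη₀ hη hc hc' hv hw
  have hw0 : 0 < w 0 := by
    have : 0 ≤ m * |v| := by positivity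
    exact (mul_pos_iff_of_pos_left hα).1 (this.trans_lt hdom)
  have hae : ∀ᵐ z ∂(source (m + 1) α β η), Real.sign (∑ i, w i * z.1 i) = Real.sign (z.1 0) := by
    filter_upwards [ae_abs_eq_source hα (fun i => (hc i).le) fun i => (hc' i).le] with z hz
    have hz0 : |z.1 0| = α := hz 0
    -- Without dropout all weak features have modulus `1`, so together they contribute at most `m *
    -- |v|`.
    have htail : |∑ i : Fin m, w i.succ * z.1 i.succ| < |w 0 * z.1 0| := by
      rw [abs_mul, hz0, abs_of_pos hw0, mul_comm]
      refine lt_of_le_of_lt ((Finset.abs_sum_le_sum_abs _ _).trans (le_of_eq ?_)) hdom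
      rw [Finset.sum_congr rfl fun i _ => show |w i.succ * z.1 i.succ| = |v| by
        rw [abs_mul, hz, hv]; simp [featureScale]]
      simp
    rw [Fin.sum_univ_succ, sign_add_eq_of_abs_lt htail, sign_mul_of_pos hw0]
  refine ⟨hae, ?_⟩
  refine (measureReal_congr ?_).trans
    (source_real_sign_ne hα hη₀.le (fun i => (hc i).le) fun i => (hc' i).le)
  filter_upwards [hae] with z hz
  exact congrArg (fun a => a ≠ z.2) hz
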